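/- \textbf{Theorem.} Let $q$ be a power of a prime $p$, and let $e,k$ be nontrivial divisors of $q-1$ (that is, $e,k>1$) with $q=ek+1$. Let $g$ be a primitive element of the finite field $\mathbb{F}_q$. For $a\in\mathbb{Z}$ put $C_a=\{g^{a},g^{a+e},\dots,g^{a+(k-1)e}\}$, and let the cyclotomic number $(a,b)$ of order $e$ be the number of solutions of $1+x=y$ with $x\in C_a$ and $y\in C_b$. Let $\varphi$ be Euler's totient function and let $\mathrm{ord}_k(p)$ be the multiplicative order of $p$ modulo $k$. If $$p>\left(\frac{14k}{\varphi(k)}\right)^{\frac{\varphi(k)}{2\,\mathrm{ord}_k(p)}},$$ then $(a,b)\le 2$ for all $a,b\in\{1,\dots,e-1\}$ with $a\neq b$. -/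

import Mathlib

/-- The cyclotomic class `C_a = {g^a, g^(a+e), …, g^(a+(k-1)e)}` in the field `F`. -/
def cyclotomicClass {F : Type*} [Field F] (g : Fˣ) (e k : ℕ) (a : ℤ) : Set F :=
  {x | ∃ r : ℕ, r < k ∧ x = ((g ^ (a + (r : ℤ) * (e : ℤ)) : Fˣ) : F)}

/-- The cyclotomic number `(a, b)` of order `e`: the number of solutions of `1 + x = y` with
`x ∈ C_a` and `y ∈ C_b`. The solution set is finite since each class has at most `k` elements. -/
noncomputable def cyclotomicNumber {F : Type*} [Field F] (g : Fˣ) (e k : ℕ) (a b : ℤ) : ℕ :=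
  Set.ncard {z : F × F |
    z.1 ∈ cyclotomicClass g e k a ∧ z.2 ∈ cyclotomicClass g e k b ∧ 1 + z.1 = z.2}

/-! Three distinct solutions give collinear points `(x i, y i)`, so the determinant `∑ (x i * y
(i+1) - x (i+1) * y i)` vanishes. Divided by the coset representatives, it is a signed sum of six
powers of `h = g ^ e`, a primitive `k`-th root of unity, and lifts to a cyclotomic integer `α`. Over
`ℂ` the points have unimodular coordinates, and conjugating the collinearity relation shows `α ≠ 0`.
Since `α` dies in `F`, its norm is at least the size of the image of `𝓞 K`, hence at least `p ^
ord_k(p)`. AM-GM and Parseval give `N(α)² ≤ (14 k / φ(k)) ^ φ(k)`, contradicting the bound on `p`.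
-/

/-! ### Parseval and AM-GM -/

theorem sum_range_mul_conj_pow {k : ℕ} {η : ℂ} (hη : IsPrimitiveRoot η k) (hk : k ≠ 0) (a b : ℕ) :
    ∑ j ∈ Finset.range k, (η ^ j) ^ a * (starRingEnd ℂ) ((η ^ j) ^ b) =
      if η ^ a = η ^ b then (k : ℂ) else 0 := by
  have hnorm : ‖η‖ = 1 := hη.norm'_eq_one hk
  have h0 : η ≠ 0 := hη.ne_zero hk
  have hc : (starRingEnd ℂ) η = η⁻¹ := (Complex.inv_eq_conj hnorm).symm
  have hw : ∀ j, (η ^ j) ^ a * (starRingEnd ℂ) ((η ^ j) ^ b) = (η ^ a * (η ^ b)⁻¹) ^ j := by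
    intro j
    simp only [map_pow, hc, mul_pow, inv_pow, ← pow_mul, mul_comm j]
  simp only [hw]
  split_ifs with h
  · rw [h, mul_inv_cancel₀ (pow_ne_zero _ h0)]
    simp
  · have hne : η ^ a * (η ^ b)⁻¹ ≠ 1 := by
      intro h1
      exact h (by rwa [mul_inv_eq_one₀ (pow_ne_zero _ h0)] at h1)
    rw [geom_sum_eq hne, mul_pow, inv_pow, ← pow_mul, ← pow_mul, mul_comm a, mul_comm b, pow_mul,
      pow_mul, hη.pow_eq_one]
    simp

/-- Parseval's identity for a sparse integer combination of powers of a root of unity. -/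
theorem sum_range_norm_sq_eq {k : ℕ} {η : ℂ} (hη : IsPrimitiveRoot η k) (hk : k ≠ 0)
    {ι : Type*} [Fintype ι] (c : ι → ℤ) (m : ι → ℕ) :
    ∑ j ∈ Finset.range k, ‖∑ i, (c i : ℂ) * (η ^ j) ^ m i‖ ^ 2 =
      k * ((∑ i, ∑ l, if η ^ m i = η ^ m l then c i * c l else 0 : ℤ) : ℝ) := by
  have hsq : ∀ z : ℂ, ((‖z‖ ^ 2 : ℝ) : ℂ) = z * (starRingEnd ℂ) z := fun z => by
    rw [Complex.mul_conj']; push_cast; rfl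
  have hgoal : ((∑ j ∈ Finset.range k, ‖∑ i, (c i : ℂ) * (η ^ j) ^ m i‖ ^ 2 : ℝ) : ℂ) =
      ((k * ((∑ i, ∑ l, if η ^ m i = η ^ m l then c i * c l else 0 : ℤ) : ℝ) : ℝ) : ℂ) := by
    rw [Complex.ofReal_sum]
    simp only [hsq, map_sum, Finset.sum_mul_sum]
    rw [Finset.sum_comm]
    push_cast
    rw [Finset.mul_sum]
    refine Finset.sum_congr rfl fun i _ => ?_
    rw [Finset.sum_comm, Finset.mul_sum]
    refine Finset.sum_congr rfl fun l _ => ?_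
    have := sum_range_mul_conj_pow hη hk (m i) (m l)
    calc _ = (c i * c l : ℂ) * ∑ j ∈ Finset.range k,
          (η ^ j) ^ m i * (starRingEnd ℂ) ((η ^ j) ^ m l) := by
          rw [Finset.mul_sum]
          refine Finset.sum_congr rfl fun j _ => ?_
          rw [map_mul, map_intCast]
          ring
      _ = _ := by
          rw [this]
          split_ifs <;> push_cast <;> ring
  exact_mod_cast hgoal

/-- Primitive roots are among all `k`-th roots, so Parseval bounds the partial sum of nonnegative
terms. -/
theorem sum_primitiveRoots_norm_sq_le {k : ℕ} {η : ℂ} (hη : IsPrimitiveRoot η k) (hk : k ≠ 0)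
    {ι : Type*} [Fintype ι] (c : ι → ℤ) (m : ι → ℕ) :
    ∑ μ ∈ primitiveRoots k ℂ, ‖∑ i, (c i : ℂ) * μ ^ m i‖ ^ 2 ≤
      k * ((∑ i, ∑ l, if η ^ m i = η ^ m l then c i * c l else 0 : ℤ) : ℝ) := by
  classical
  rw [← sum_range_norm_sq_eq hη hk c m]
  have hinj : Set.InjOn (fun j => η ^ j) (Finset.range k : Set ℕ) := by
    intro i hi j hj h
    exact hη.pow_inj (by simpa using hi) (by simpa using hj) h
  rw [← Finset.sum_image (f := fun μ => ‖∑ i, (c i : ℂ) * μ ^ m i‖ ^ 2) hinj]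
  refine Finset.sum_le_sum_of_subset_of_nonneg ?_ fun _ _ _ => by positivity
  intro μ hμ
  have hμ' := (mem_primitiveRoots (Nat.pos_of_ne_zero hk)).1 hμ
  have : NeZero k := ⟨hk⟩
  obtain ⟨i, hi, rfl⟩ := hη.eq_pow_of_pow_eq_one hμ'.pow_eq_one
  exact Finset.mem_image.2 ⟨i, Finset.mem_range.2 hi, rfl⟩

/-- AM-GM inequality for the uniform weight. -/
theorem prod_le_arith_mean_pow {ι : Type*} (s : Finset ι) (z : ι → ℝ) (hz : ∀ i ∈ s, 0 ≤ z i)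
    (hs : s.Nonempty) : ∏ i ∈ s, z i ≤ ((∑ i ∈ s, z i) / s.card) ^ s.card := by
  have hc : (0 : ℝ) < s.card := by exact_mod_cast hs.card_pos
  have h := Real.geom_mean_le_arith_mean s (fun _ => 1) z (fun _ _ => zero_le_one)
    (by simpa using hc) hz
  simp only [Real.rpow_one, one_mul, Finset.sum_const, nsmul_eq_mul, mul_one] at h
  have hp : 0 ≤ ∏ i ∈ s, z i := Finset.prod_nonneg hz
  calc _ = ((∏ i ∈ s, z i) ^ ((s.card : ℝ)⁻¹)) ^ s.card := by
        rw [Real.rpow_inv_natCast_pow hp hs.card_pos.ne']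
    _ ≤ _ := pow_le_pow_left₀ (Real.rpow_nonneg hp _) h _

/-! ### Norms of cyclotomic integers against residue rings -/

/-- A subring of a finite field of characteristic `p` that contains a primitive `k`-th root of
unity has at least `p ^ ord_k(p)` elements. -/
theorem pow_orderOf_le_card_subring {F : Type*} [Field F] [Finite F] {p n k : ℕ} (hp : p.Prime)
    (hF : Nat.card F = p ^ n) {h : F} (hk : k ≠ 0) (hh : IsPrimitiveRoot h k) (R : Subring F) (hR : h ∈ R) :
    p ^ orderOf (p : ZMod k) ≤ Nat.card R := by
  classical
  let _ := Fintype.ofFinite R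
  let _ := Fintype.fieldOfDomain R
  have hdvd : Nat.card R ∣ p ^ n := hF ▸ AddSubgroup.card_addSubgroup_dvd_card R.toAddSubgroup
  obtain ⟨m, -, hm⟩ := (Nat.dvd_prime_pow hp).1 hdvd
  have h0 : (⟨h, hR⟩ : R) ≠ 0 := fun h1 => hh.ne_zero hk (congrArg Subtype.val h1)
  -- The order `k` of `h` divides `|R| - 1 = p ^ m - 1`, hence `ord_k(p) ∣ m`.
  have h1 := FiniteField.pow_card_sub_one_eq_one (⟨h, hR⟩ : R) h0
  rw [← Nat.card_eq_fintype_card, hm] at h1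
  have hkd : k ∣ p ^ m - 1 := hh.dvd_of_pow_eq_one _ (congrArg Subtype.val h1)
  have hpm : 1 ≤ p ^ m := Nat.one_le_pow _ _ hp.pos
  have hz : (p : ZMod k) ^ m = 1 := by
    have := (ZMod.natCast_eq_zero_iff _ _).2 hkd
    rw [Nat.cast_sub hpm] at this
    push_cast at this
    exact sub_eq_zero.1 this
  have hm0 : 0 < m := by
    refine Nat.pos_of_ne_zero fun hm0 => ?_
    have : 1 < Nat.card R := Finite.one_lt_card
    rw [hm, hm0] at this
    simp at this
  rw [hm]
  exact Nat.pow_le_pow_right hp.pos (Nat.le_of_dvd hm0 (orderOf_dvd_of_pow_eq_one hz))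

open Polynomial NumberField

/-- A primitive `k`-th root of unity in a field of characteristic prime to `k` lifts to a ring
homomorphism from the ring of integers of the cyclotomic field. -/
theorem exists_ringHom_ringOfIntegers_toInteger {K : Type*} [Field K] [NumberField K] {k : ℕ}
    [NeZero k] [IsCyclotomicExtension {k} ℚ K] {ζ : K} (hζ : IsPrimitiveRoot ζ k)
    {F : Type*} [Field F] {h : F} (hh : IsPrimitiveRoot h k) :
    ∃ φ : 𝓞 K →+* F, φ hζ.toInteger = h := by
  have hmin : minpoly ℤ hζ.integralPowerBasis.gen = cyclotomic k ℤ := by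
    rw [hζ.integralPowerBasis_gen, cyclotomic_eq_minpoly hζ (NeZero.pos k),
      ← RingOfIntegers.minpoly_coe]
    rfl
  have hroot : aeval h (minpoly ℤ hζ.integralPowerBasis.gen) = 0 := by
    rw [hmin, aeval_def, eval₂_eq_eval_map, map_cyclotomic]
    exact hh.isRoot_cyclotomic (NeZero.pos k)
  refine ⟨(hζ.integralPowerBasis.lift h hroot).toRingHom, ?_⟩
  rw [← hζ.integralPowerBasis_gen]
  exact hζ.integralPowerBasis.lift_gen h hroot

/-- An algebraic integer in the kernel of a ring homomorphism to a finite field has norm at least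
the size of the image, unless it vanishes. -/
theorem card_range_le_natAbs_norm {K : Type*} [Field K] [NumberField K]
    {F : Type*} [Field F] (φ : 𝓞 K →+* F) {α : 𝓞 K} (hα : φ α = 0) (h0 : α ≠ 0) :
    Nat.card φ.range ≤ (Algebra.norm ℤ α).natAbs := by
  have h1 : Ideal.span {α} ≤ RingHom.ker φ := by
    rw [Ideal.span_singleton_le_iff_mem]
    exact hα
  have h2 := Ideal.absNorm_dvd_absNorm_of_le h1
  rw [Ideal.absNorm_span_singleton] at h2
  have h3 : Ideal.absNorm (RingHom.ker φ) = Nat.card φ.range := by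
    rw [Ideal.absNorm_apply, Submodule.cardQuot_apply]
    exact Nat.card_congr (RingHom.quotientKerEquivRange φ).toEquiv
  rw [← h3]
  exact Nat.le_of_dvd (Int.natAbs_pos.2 (Algebra.norm_ne_zero_iff.2 h0)) h2

/-- The norm is the product of the values at the primitive roots; AM-GM over these `φ(k)` factors
reduces it to the mean square. -/
theorem norm_sq_le_of_cyclotomic {K : Type*} [Field K] [NumberField K] {k : ℕ}
    [NeZero k] [IsCyclotomicExtension {k} ℚ K] {ζ : K} (hζ : IsPrimitiveRoot ζ k)
    {η : ℂ} (hη : IsPrimitiveRoot η k) {ι : Type*} [Fintype ι] (c : ι → ℤ) (m : ι → ℕ) :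
    ((Algebra.norm ℤ (∑ i, (c i : 𝓞 K) * hζ.toInteger ^ m i)).natAbs : ℝ) ^ 2 ≤
      (k * ((∑ i, ∑ l, if η ^ m i = η ^ m l then c i * c l else 0 : ℤ) : ℝ) / k.totient) ^
        k.totient := by
  set α := ∑ i, (c i : 𝓞 K) * hζ.toInteger ^ m i with hα
  have hk : k ≠ 0 := NeZero.ne k
  have hirr : Irreducible (cyclotomic k ℚ) := cyclotomic.irreducible_rat (NeZero.pos k)
  have hcard : (primitiveRoots k ℂ).card = k.totient := hη.card_primitiveRoots
  have hσ : ∀ σ : K →ₐ[ℚ] ℂ, σ (α : K) = ∑ i, (c i : ℂ) * (σ ζ) ^ m i := by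
    intro σ
    simp only [hα, map_sum, map_mul, map_pow, map_intCast]
    rfl
  have hnorm : (((Algebra.norm ℤ α : ℤ) : ℚ) : ℂ) =
      ∏ μ ∈ primitiveRoots k ℂ, ∑ i, (c i : ℂ) * μ ^ m i := by
    have h1 := Algebra.norm_eq_prod_embeddings ℚ ℂ (α : K)
    rw [← Algebra.coe_norm_int] at h1
    rw [← Finset.prod_coe_sort (primitiveRoots k ℂ)]
    refine h1.trans (Fintype.prod_equiv (hζ.embeddingsEquivPrimitiveRoots ℂ hirr) _ _ fun σ => ?_)
    rw [hσ, IsPrimitiveRoot.embeddingsEquivPrimitiveRoots_apply_coe]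
  have habs : ((Algebra.norm ℤ α).natAbs : ℝ) ^ 2 =
      ∏ μ ∈ primitiveRoots k ℂ, ‖∑ i, (c i : ℂ) * μ ^ m i‖ ^ 2 := by
    rw [Finset.prod_pow, ← norm_prod, ← hnorm]
    simp
  rw [habs]
  have hne : (primitiveRoots k ℂ).Nonempty := ⟨η, (mem_primitiveRoots (NeZero.pos k)).2 hη⟩
  refine (prod_le_arith_mean_pow _ _ (fun _ _ => by positivity) hne).trans ?_
  rw [hcard]
  refine pow_le_pow_left₀ (by positivity) ?_ _
  gcongr
  exact sum_primitiveRoots_norm_sq_le hη hk c m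

/-- If an integer combination of powers of a primitive `k`-th root of unity vanishes in a finite
field of characteristic `p` but not in `ℂ`, then `p` is small. -/
theorem pow_orderOf_sq_le_of_sum_eq_zero {F : Type*} [Field F] [Finite F] {p n k : ℕ}
    (hp : p.Prime) (hF : Nat.card F = p ^ n) (hk : k ≠ 0) {h : F} (hh : IsPrimitiveRoot h k)
    {η : ℂ} (hη : IsPrimitiveRoot η k) {ι : Type*} [Fintype ι] (c : ι → ℤ) (m : ι → ℕ)
    (hsum : ∑ i, (c i : F) * h ^ m i = 0) (hne : ∑ i, (c i : ℂ) * η ^ m i ≠ 0) :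
    ((p : ℝ) ^ orderOf (p : ZMod k)) ^ 2 ≤
      (k * ((∑ i, ∑ l, if η ^ m i = η ^ m l then c i * c l else 0 : ℤ) : ℝ) / k.totient) ^
        k.totient := by
  have : NeZero k := ⟨hk⟩
  have : @IsCyclotomicExtension {k} ℚ (CyclotomicField k ℚ) _ _ DivisionRing.toRatAlgebra := by
    convert CyclotomicField.isCyclotomicExtension k ℚ
    · rfl
    · exact Subsingleton.elim (α := Algebra ℚ (CyclotomicField k ℚ)) _ _
  have hζ := IsCyclotomicExtension.zeta_spec k ℚ (CyclotomicField k ℚ)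
  obtain ⟨φ, hφ⟩ := exists_ringHom_ringOfIntegers_toInteger hζ hh
  obtain ⟨ψ, hψ⟩ := exists_ringHom_ringOfIntegers_toInteger hζ hη
  refine le_trans ?_ (norm_sq_le_of_cyclotomic hζ hη c m)
  refine pow_le_pow_left₀ (by positivity) ?_ 2
  have h1 := pow_orderOf_le_card_subring hp hF hk hh φ.range ⟨_, hφ⟩
  have h2 := card_range_le_natAbs_norm φ
    (α := ∑ i, (c i : 𝓞 (CyclotomicField k ℚ)) * hζ.toInteger ^ m i) (by simpa [hφ] using hsum) (by
      intro h0
      apply hne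
      simpa [hψ] using congrArg ψ h0)
  exact_mod_cast h1.trans h2

/-! ### The constant 14 = 9 + 5 -/

theorem sum_ite_eq_le_nine {T : Type*} [DecidableEq T] (f : Fin 3 → T) :
    ∑ i, ∑ l, (if f i = f l then (1 : ℤ) else 0) ≤ 9 := by
  refine (Finset.sum_le_sum fun i _ => Finset.sum_le_sum fun l _ =>
    (ite_le_one le_rfl zero_le_one : (if f i = f l then (1 : ℤ) else 0) ≤ 1)).trans ?_
  simp

/-- The worst split of three terms is 2 + 1, giving 4 + 1 coincidences. -/
theorem sum_ite_eq_le_five {T : Type*} [DecidableEq T] (f : Fin 3 → T)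
    (hf : ¬ (f 0 = f 1 ∧ f 1 = f 2)) :
    ∑ i, ∑ l, (if f i = f l then (1 : ℤ) else 0) ≤ 5 := by
  simp only [Fin.sum_univ_three]
  grind

/-- The number of coincidences between the signed terms `P 0, P 1, P 2` and `-N 0, -N 1, -N 2`. -/
theorem sum_signed_coincidences_le {T : Type*} [DecidableEq T] (P N : Fin 3 → T)
    (hPN : ∀ i j, P i ≠ N j) (h : ¬ ((P 0 = P 1 ∧ P 1 = P 2) ∧ (N 0 = N 1 ∧ N 1 = N 2))) :
    ∑ i : Fin 3 ⊕ Fin 3, ∑ l : Fin 3 ⊕ Fin 3,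
      (if Sum.elim P N i = Sum.elim P N l then
        (Sum.elim (fun _ => 1) (fun _ => -1) i : ℤ) * Sum.elim (fun _ => 1) (fun _ => -1) l
      else 0) ≤ 14 := by
  simp only [Fintype.sum_sum_type, Sum.elim_inl, Sum.elim_inr, hPN, fun i j => (hPN i j).symm,
    if_false, Finset.sum_const_zero, add_zero, zero_add, mul_one, mul_neg, neg_neg]
  rcases not_and_or.1 h with h | h
  · refine le_trans (le_of_eq ?_) (add_le_add (sum_ite_eq_le_five P h) (sum_ite_eq_le_nine N))
    congr!
  · refine le_trans (le_of_eq ?_) (add_le_add (sum_ite_eq_le_nine P) (sum_ite_eq_le_five N h))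
    congr!

/-! ### Collinear triples over `ℂ` and over `F` -/

/-- If the points `(u i, v i)` with coordinates on the unit circle are collinear, then two
coordinates coincide or `u₁ v₂ = u₂ v₁`. -/
theorem mul_eq_mul_of_collinear_of_norm_eq_one {u₀ u₁ u₂ v₀ v₁ v₂ : ℂ}
    (hu₀ : ‖u₀‖ = 1) (hu₁ : ‖u₁‖ = 1) (hu₂ : ‖u₂‖ = 1)
    (hv₀ : ‖v₀‖ = 1) (hv₁ : ‖v₁‖ = 1) (hv₂ : ‖v₂‖ = 1)
    (h : (u₁ - u₀) * (v₂ - v₀) = (u₂ - u₀) * (v₁ - v₀)) (hu : u₀ ≠ u₁) (hv : v₂ ≠ v₀) :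
    u₁ * v₂ = u₂ * v₁ := by
  have hn : ∀ {z : ℂ}, ‖z‖ = 1 → z ≠ 0 := fun hz h0 => by simp [h0] at hz
  have hc := congrArg (starRingEnd ℂ) h
  simp only [map_mul, map_sub, ← Complex.inv_eq_conj hu₀, ← Complex.inv_eq_conj hu₁,
    ← Complex.inv_eq_conj hu₂, ← Complex.inv_eq_conj hv₀, ← Complex.inv_eq_conj hv₁,
    ← Complex.inv_eq_conj hv₂] at hc
  have h0 := hn hu₀
  have h1 := hn hu₁
  have h2 := hn hu₂
  have k0 := hn hv₀
  have k1 := hn hv₁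
  have k2 := hn hv₂
  field_simp at hc
  -- The conjugated relation is the original one with its two sides weighted by `u₂ * v₁` and `u₁ *
  -- v₂`; cancelling the common nonzero value leaves the claim.
  have hA : (u₁ - u₀) * (v₂ - v₀) ≠ 0 := mul_ne_zero (sub_ne_zero.2 hu.symm) (sub_ne_zero.2 hv)
  refine mul_left_cancel₀ hA ?_
  linear_combination -hc + u₁ * v₂ * h

section Field

variable {F : Type*} [Field F] {x y : Fin 3 → F}

/-- No positive term of the determinant equals a negative one: for each residue of `j - i` mod 3,
equality forces two `x` or two `y` to agree. -/
theorem mul_succ_ne_succ_mul (hxy : ∀ i, 1 + x i = y i) (hx : Function.Injective x)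
    (hx0 : ∀ i, x i ≠ 0) (hy0 : ∀ i, y i ≠ 0) (i j : Fin 3) :
    x i * y (i + 1) ≠ x (j + 1) * y j := by
  have hy : Function.Injective y := fun a b hab => hx (by
    rw [← hxy, ← hxy] at hab
    exact add_left_cancel hab)
  intro h
  have h3 : j = i ∨ j = i + 1 ∨ j = i + 2 := by clear h; revert i j; decide
  rcases h3 with rfl | rfl | rfl
  · rw [← hxy, ← hxy] at h
    exact absurd (hx (by linear_combination h : x j = x (j + 1))) (by clear h; revert j; decide)
  · exact absurd (hx (mul_right_cancel₀ (hy0 _) h)) (by clear h; revert i; decide)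
  · rw [show i + 2 + 1 = i by clear h; revert i; decide] at h
    exact absurd (hy (mul_left_cancel₀ (hx0 _) h)) (by clear h; revert i; decide)

/-- Otherwise all cyclic differences of `x` equal some `t`, so `3t = 0`; the product equations give
`2t = 0`, so `t = 0` in every characteristic. -/
theorem not_all_mul_succ_eq (hxy : ∀ i, 1 + x i = y i) (hx : Function.Injective x) :
    ¬ ((x 0 * y 1 = x 1 * y 2 ∧ x 1 * y 2 = x 2 * y 0) ∧
      (x 1 * y 0 = x 2 * y 1 ∧ x 2 * y 1 = x 0 * y 2)) := by
  rintro ⟨⟨h1, h2⟩, h3, h4⟩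
  simp only [← hxy] at h1 h2 h3 h4
  have hne : x 1 - x 0 ≠ 0 := sub_ne_zero.2 (hx.ne (by decide))
  obtain ⟨t, ht⟩ : ∃ t, t = x 1 - x 0 := ⟨_, rfl⟩
  rw [← ht] at hne
  have ht1 : t = x 2 - x 1 := by linear_combination ht + h3 - h1
  have ht2 : t = x 0 - x 2 := by linear_combination ht1 + h4 - h2
  have h3t : 3 * t = 0 := by linear_combination ht + ht1 + ht2
  have e1 : 2 * x 0 + 1 + 2 * t = 0 := by
    refine (mul_eq_zero.1 ?_).resolve_left hne
    have hx1 : x 1 = x 0 + t := by linear_combination -ht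
    have hx2 : x 2 = x 0 + 2 * t := by linear_combination -ht - ht1
    rw [hx1, hx2] at h1
    linear_combination -h1
  have e2 : 2 * x 1 + 1 + 2 * t = 0 := by
    refine (mul_eq_zero.1 ?_).resolve_left hne
    have hx2 : x 2 = x 1 + t := by linear_combination -ht1
    have hx0 : x 0 = x 1 + 2 * t := by linear_combination -ht1 - ht2
    rw [hx0, hx2] at h2
    linear_combination -h2
  exact hne (by linear_combination h3t - e2 + e1 - 2 * ht)

end Field

/-! ### From three solutions to the bound -/

theorem exists_eq_mul_pow_of_mem_cyclotomicClass {F : Type*} [Field F] (g : Fˣ) (e k : ℕ) (a : ℤ) {x : F}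
    (hx : x ∈ cyclotomicClass g e k a) :
    ∃ r : ℕ, x = ((g ^ a : Fˣ) : F) * ((g ^ e : Fˣ) : F) ^ r := by
  obtain ⟨r, -, rfl⟩ := hx
  refine ⟨r, ?_⟩
  rw [zpow_add, Units.val_mul, mul_comm (r : ℤ), zpow_mul, zpow_natCast, zpow_natCast,
    Units.val_pow_eq_pow_val]

/-- Three solutions of `1 + x = y` with `x` and `y` in fixed cosets of the group of `k`-th roots of
unity force the characteristic to be small. -/
theorem pow_orderOf_sq_le_of_three_solutions {F : Type*} [Field F] [Finite F] {p n k : ℕ}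
    (hp : p.Prime) (hF : Nat.card F = p ^ n) (hk : k ≠ 0) {h : F} (hh : IsPrimitiveRoot h k)
    {A B : F} (hA : A ≠ 0) (hB : B ≠ 0) (r s : Fin 3 → ℕ)
    (hsol : ∀ i, 1 + A * h ^ r i = B * h ^ s i)
    (hinj : Function.Injective fun i => A * h ^ r i) :
    ((p : ℝ) ^ orderOf (p : ZMod k)) ^ 2 ≤ (14 * k / k.totient) ^ k.totient := by
  classical
  obtain ⟨η, hη⟩ : ∃ η : ℂ, IsPrimitiveRoot η k := ⟨_, Complex.isPrimitiveRoot_exp k hk⟩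
  have hh0 : h ≠ 0 := hh.ne_zero hk
  -- `η` and `h` both have order `k`, so coincidences of powers transfer between `ℂ` and `F`.
  have hiff : ∀ a b : ℕ, η ^ a = η ^ b ↔ h ^ a = h ^ b := fun a b => by
    rw [(hη.isOfFinOrder hk).pow_eq_pow_iff_modEq, (hh.isOfFinOrder hk).pow_eq_pow_iff_modEq, ← hη.eq_orderOf,
      ← hh.eq_orderOf]
  set P : Fin 3 → ℕ := fun i => r i + s (i + 1) with hP
  set N : Fin 3 → ℕ := fun i => r (i + 1) + s i with hN
  set x : Fin 3 → F := fun i => A * h ^ r i with hx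
  set y : Fin 3 → F := fun i => B * h ^ s i with hy
  have hxP : ∀ i, x i * y (i + 1) = A * B * h ^ P i := fun i => by
    simp only [hx, hy, hP, pow_add]; ring
  have hxN : ∀ i, x (i + 1) * y i = A * B * h ^ N i := fun i => by
    simp only [hx, hy, hN, pow_add]; ring
  have hAB : A * B ≠ 0 := mul_ne_zero hA hB
  have hx0 : ∀ i, x i ≠ 0 := fun i => mul_ne_zero hA (pow_ne_zero _ hh0)
  have hy0 : ∀ i, y i ≠ 0 := fun i => mul_ne_zero hB (pow_ne_zero _ hh0)
  have hPN : ∀ i j, η ^ P i ≠ η ^ N j := fun i j hij => by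
    refine mul_succ_ne_succ_mul hsol hinj hx0 hy0 i j ?_
    rw [hxP, hxN, (hiff _ _).1 hij]
  have hall : ¬ ((η ^ P 0 = η ^ P 1 ∧ η ^ P 1 = η ^ P 2) ∧
      (η ^ N 0 = η ^ N 1 ∧ η ^ N 1 = η ^ N 2)) := by
    simp only [hiff]
    rintro ⟨⟨h1, h2⟩, h3, h4⟩
    refine not_all_mul_succ_eq hsol hinj ⟨⟨?_, ?_⟩, ?_, ?_⟩
    · exact (hxP 0).trans (by rw [h1]; exact (hxP 1).symm)
    · exact (hxP 1).trans (by rw [h2]; exact (hxP 2).symm)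
    · exact (hxN 0).trans (by rw [h3]; exact (hxN 1).symm)
    · exact (hxN 1).trans (by rw [h4]; exact (hxN 2).symm)
  have hsum : ∑ i : Fin 3 ⊕ Fin 3, ((Sum.elim (fun _ => 1) (fun _ => -1) i : ℤ) : F) *
      h ^ Sum.elim P N i = 0 := by
    refine (mul_eq_zero.1 ?_).resolve_left hAB
    have hP' : ∀ i, x i * (1 + x (i + 1)) = A * B * h ^ P i := fun i =>
      (congrArg (x i * ·) (hsol (i + 1))).trans (hxP i)
    have hN' : ∀ i, x (i + 1) * (1 + x i) = A * B * h ^ N i := fun i =>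
      (congrArg (x (i + 1) * ·) (hsol i)).trans (hxN i)
    have e0 : x 0 * (1 + x 1) = _ := hP' 0
    have e1 : x 1 * (1 + x 2) = _ := hP' 1
    have e2 : x 2 * (1 + x 0) = _ := hP' 2
    have d0 : x 1 * (1 + x 0) = _ := hN' 0
    have d1 : x 2 * (1 + x 1) = _ := hN' 1
    have d2 : x 0 * (1 + x 2) = _ := hN' 2
    simp only [Fintype.sum_sum_type, Sum.elim_inl, Sum.elim_inr, Fin.sum_univ_three]
    push_cast
    -- The products cancel and `∑ (x i - x (i+1))` telescopes to zero.
    linear_combination -e0 - e1 - e2 + d0 + d1 + d2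
  have hne : ∑ i : Fin 3 ⊕ Fin 3, ((Sum.elim (fun _ => 1) (fun _ => -1) i : ℤ) : ℂ) *
      η ^ Sum.elim P N i ≠ 0 := by
    intro h0
    simp only [Fintype.sum_sum_type, Sum.elim_inl, Sum.elim_inr, Fin.sum_univ_three, hP, hN,
      show (0 : Fin 3) + 1 = 1 from rfl, show (1 : Fin 3) + 1 = 2 from rfl,
      show (2 : Fin 3) + 1 = 0 from rfl, pow_add] at h0
    push_cast at h0
    have hn : ∀ m : ℕ, ‖η ^ m‖ = 1 := fun m => by
      rw [norm_pow, hη.norm'_eq_one hk, one_pow]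
    -- Vanishing would make the unimodular points collinear, forcing the excluded coincidence `η ^ P
    -- 1 = η ^ N 1`.
    refine hPN 1 1 ?_
    simp only [hP, hN, pow_add, show (1 : Fin 3) + 1 = 2 from rfl]
    refine mul_eq_mul_of_collinear_of_norm_eq_one (hn (r 0)) (hn _) (hn _) (hn (s 0)) (hn _) (hn _)
      (by linear_combination h0) ?_ ?_
    · intro h1
      exact absurd (hinj (by simp only [hx, (hiff _ _).1 h1] : x 0 = x 1)) (by decide)
    · intro h1
      have h2 : y 2 = y 0 := by simp only [hy, (hiff _ _).1 h1]
      exact absurd (hinj (add_left_cancel ((hsol 2).trans (h2.trans (hsol 0).symm)))) (by decide)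
  refine (pow_orderOf_sq_le_of_sum_eq_zero hp hF hk hh hη _ _ hsum hne).trans ?_
  have hcount := sum_signed_coincidences_le (fun i => η ^ P i) (fun i => η ^ N i) hPN hall
  have helim : ∀ i : Fin 3 ⊕ Fin 3, Sum.elim (fun i => η ^ P i) (fun i => η ^ N i) i =
      η ^ Sum.elim P N i := by rintro (i | i) <;> rfl
  simp only [helim] at hcount
  refine pow_le_pow_left₀ ?_ ?_ _
  · rw [← sum_range_norm_sq_eq hη hk]
    positivity
  · rw [mul_comm (14 : ℝ)]
    gcongr
    exact_mod_cast hcount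

theorem mainTheorem7 {F : Type*} [Field F] [Finite F]
    (p n q e k : ℕ) (hp : p.Prime) (hq : q = p ^ n) (hF : Nat.card F = q)
    (he : 1 < e) (hk : 1 < k) (hek : q = e * k + 1)
    (g : Fˣ) (hg : ∀ x : Fˣ, x ∈ Subgroup.zpowers g)
    (hbound : (p : ℝ) > (14 * (k : ℝ) / (Nat.totient k : ℝ)) ^
      ((Nat.totient k : ℝ) / (2 * (orderOf (p : ZMod k) : ℝ))))
    (a b : ℤ) (ha : 1 ≤ a ∧ a ≤ (e : ℤ) - 1) (hb : 1 ≤ b ∧ b ≤ (e : ℤ) - 1) (hab : a ≠ b) :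
    cyclotomicNumber g e k a b ≤ 2 := by
  have hk0 : k ≠ 0 := by omega
  have hcard : Nat.card Fˣ = e * k := by
    rw [Nat.card_units, hF, hek, Nat.add_sub_cancel]
  have hord : orderOf g = e * k := by
    rw [← hcard]
    exact orderOf_eq_card_of_forall_mem_zpowers hg
  have hh : IsPrimitiveRoot ((g ^ e : Fˣ) : F) k :=
    (((IsPrimitiveRoot.orderOf g).pow (orderOf_pos g) hord).map_of_injective
      (f := Units.coeHom F) Units.val_injective)
  by_contra! hlt
  obtain ⟨z₀, z₁, z₂, hz₀, hz₁, hz₂, h01, h02, h12⟩ :=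
    (Set.two_lt_ncard_iff (Set.toFinite _)).1 hlt
  have hz : ∀ i : Fin 3, (![z₀, z₁, z₂] i).1 ∈ cyclotomicClass g e k a ∧
      (![z₀, z₁, z₂] i).2 ∈ cyclotomicClass g e k b ∧
      1 + (![z₀, z₁, z₂] i).1 = (![z₀, z₁, z₂] i).2 := by
    intro i
    fin_cases i
    exacts [hz₀, hz₁, hz₂]
  have hinj : Function.Injective ![z₀, z₁, z₂] := by
    intro i j hij
    fin_cases i <;> fin_cases j <;> simp_all
  choose r hr using fun i => exists_eq_mul_pow_of_mem_cyclotomicClass g e k a (hz i).1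
  choose s hs using fun i => exists_eq_mul_pow_of_mem_cyclotomicClass g e k b (hz i).2.1
  have hle := pow_orderOf_sq_le_of_three_solutions hp (hF.trans hq) hk0 hh (Units.ne_zero (g ^ a))
    (Units.ne_zero (g ^ b)) r s (fun i => by rw [← hr, ← hs]; exact (hz i).2.2) (by
      intro i j hij
      simp only [← hr] at hij
      exact hinj (Prod.ext hij (by rw [← (hz i).2.2, ← (hz j).2.2, hij])))
  -- Coprimality rules out the default value 0 of `orderOf`.
  have hcop : Nat.Coprime p k := by
    have hn : n ≠ 0 := by
      rintro rfl
      rw [pow_zero] at hq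
      have : 0 < e * k := by positivity
      omega
    refine Nat.Coprime.coprime_dvd_left (dvd_pow_self p hn) ?_
    rw [← hq, hek]
    simp
  have hf : 0 < orderOf (p : ZMod k) := by
    have : NeZero k := ⟨hk0⟩
    rw [← ZMod.coe_unitOfCoprime p hcop, orderOf_units]
    exact orderOf_pos _
  set f := orderOf (p : ZMod k)
  have hφ : 0 < k.totient := Nat.totient_pos.2 (by omega)
  have hC : (0 : ℝ) ≤ 14 * k / k.totient := by positivity
  have hlt' := pow_lt_pow_left₀ hbound (Real.rpow_nonneg hC _) (n := f * 2) (by omega)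
  rw [← Real.rpow_mul_natCast hC, pow_mul (p : ℝ)] at hlt'
  have hexp : (k.totient : ℝ) / (2 * f) * ((f * 2 : ℕ) : ℝ) = k.totient := by
    have : (f : ℝ) ≠ 0 := by exact_mod_cast hf.ne'
    push_cast
    field_simp
  rw [hexp, Real.rpow_natCast] at hlt'
  exact absurd hle (not_le.2 hlt')
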